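/- Let $G$ be one of the groups $A_4$, $A_5$, $S_4$, acting faithfully on $M_2(\mathbb{C})$ by $\mathbb{C}$-algebra automorphisms (so that $G$ also acts on the Lie algebra $sl_2(\mathbb{C})$ of traceless matrices). Let $v_1=e_{11}-e_{22}$, $v_2=e_{12}$, $v_3=e_{21}$ be the standard basis of $sl_2(\mathbb{C})$, and let $J_0$ be the ideal of all elements of the group algebra $\mathbb{C}G$ that annihilate $sl_2(\mathbb{C})$. The free $G$-algebra $\mathbb{C}\langle X;G\rangle$ is the free associative unital algebra on the symbols $x_i^g$ ($i$ in a countably infinite index set, $g\in G$), with $G$ acting by $(x_i^{h})^g=x_i^{gh}$; $L\langle X;G\rangle$ is the Lie subalgebra of $\mathbb{C}\langle X;G\rangle^{(-)}$ generated by all $x_i^g$. For $z=\sum_g z_g g\in\mathbb{C}G$ put $z(x_i)=\sum_g z_g x_i^g$, and write $x_i=x_i^{1}$. A $G$-polynomial $f\in\mathbb{C}\langle X;G\rangle$ is a weak $G$-identity of the pair $(M_2(\mathbb{C}),sl_2(\mathbb{C}))$ if it vanishes under every substitution $x_i^g\mapsto g(a_i)$ with all $a_i\in sl_2(\mathbb{C})$.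 A weak $G$-ideal is a two-sided ideal of $\mathbb{C}\langle X;G\rangle$ invariant under all algebra endomorphisms of $\mathbb{C}\langle X;G\rangle$ that commute with the action of $G$ and map $L\langle X;G\rangle$ into itself. A set $S$ of $G$-polynomials is a basis of the weak $G$-identities of the pair if the set of all weak $G$-identities of the pair is the least weak $G$-ideal containing $S$. **Theorem.** There is a unique family $(\epsilon_{ij})_{1\le i,j\le 3}$ of elements of $\mathbb{C}G$ such that all $\epsilon_{ij}$ lie in a two-sided ideal $J_1$ with $\mathbb{C}G=J_0\oplus J_1$, and $\epsilon_{ij}(v_k)=\delta_{jk}v_i$ for all $i,j,k$. These elements are matrix units, that is, $\epsilon_{ij}\epsilon_{kl}=\delta_{jk}\epsilon_{il}$, and the following $G$-polynomials (a relation $p=q$ stands for $p-q$) form a basis of the weak $G$-identities of the pair $(M_2(\mathbb{C}),sl_2(\mathbb{C}))$: 1. $\epsilon_{11}(x_1)+\epsilon_{22}(x_1)+\epsilon_{33}(x_1)=x_1$; 2. $[\epsilon_{1\alpha}(x_1),\epsilon_{1\beta}(x_2)]=0$ for $\alpha,\beta\in\{1,2,3\}$; 3. $\epsilon_{1\alpha}(x_1)\epsilon_{ij}(x_2)+\epsilon_{ij}(x_2)\epsilon_{1\alpha}(x_1)=0$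 for $i\in\{2,3\}$ and $j,\alpha\in\{1,2,3\}$; 4. $\epsilon_{i\alpha}(x_1)\epsilon_{j\beta}(x_2)\epsilon_{i\gamma}(x_3)=\epsilon_{1\alpha}(x_1)\epsilon_{1\beta}(x_2)\epsilon_{i\gamma}(x_3)$ for $i,j\in\{2,3\}$, $i\ne j$, and $\alpha,\beta,\gamma\in\{1,2,3\}$; 5. $\epsilon_{i\alpha}(x_1)\epsilon_{i\beta}(x_2)=0$ for $i\in\{2,3\}$ and $\alpha,\beta\in\{1,2,3\}$; 6. $\epsilon_{3\alpha}(x_1)\epsilon_{2\beta}(x_2)+\epsilon_{2\beta}(x_2)\epsilon_{3\alpha}(x_1)=\epsilon_{1\alpha}(x_1)\epsilon_{1\beta}(x_2)$ for $\alpha,\beta\in\{1,2,3\}$; 7. $\epsilon_{1\alpha}(x_1)\epsilon_{j\beta}(x_2)=\epsilon_{1\beta}(x_2)\epsilon_{j\alpha}(x_1)$ for $j\in\{2,3\}$ and $\alpha,\beta\in\{1,2,3\}$; 8. $\epsilon_{2\alpha}(x_1)\epsilon_{3\beta}(x_2)=\epsilon_{2\beta}(x_2)\epsilon_{3\alpha}(x_1)$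 for $\alpha,\beta\in\{1,2,3\}$. -/

import Mathlib

namespace WeakGIdentities

noncomputable section

attribute [local instance 100] LieRing.ofAssociativeRing

/-- The algebra `M₂(ℂ)`. -/
abbrev M2 : Type := Matrix (Fin 2) (Fin 2) ℂ

/-- The Lie algebra `sl₂(ℂ)` of traceless matrices, as a Lie subalgebra of `M₂(ℂ)` with the
commutator bracket. -/
abbrev sl2 : LieSubalgebra ℂ M2 := LieAlgebra.SpecialLinear.sl (Fin 2) ℂ

/-- The basis `v₁ = e₁₁ - e₂₂`, `v₂ = e₁₂`, `v₃ = e₂₁` of `sl₂(ℂ)` (indexed from `0`). -/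
def v : Fin 3 → M2 := ![!![1, 0; 0, -1], !![0, 1; 0, 0], !![0, 0; 1, 0]]

variable {G : Type*} [Group G]

/-- The free associative unital `G`-algebra `ℂ⟨X; G⟩`: the free algebra on the symbols `xᵢ^g`,
`i ∈ ℕ`, `g ∈ G`. Here `(i, g)` stands for `xᵢ^g`. -/
abbrev FreeGAlgebra (G : Type*) : Type _ := FreeAlgebra ℂ (ℕ × G)

/-- The variable `xᵢ^g`. -/
abbrev X (i : ℕ) (g : G) : FreeGAlgebra G := FreeAlgebra.ι ℂ (i, g)

/-- The action of `G` on `ℂ⟨X; G⟩` by algebra endomorphisms: `g` sends `xᵢ^h` to `xᵢ^(gh)`. -/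
def gAct (g : G) : FreeGAlgebra G →ₐ[ℂ] FreeGAlgebra G :=
  FreeAlgebra.lift ℂ fun p : ℕ × G => X p.1 (g * p.2)

/-- The free Lie `G`-algebra `L⟨X; G⟩`: the Lie subalgebra of `ℂ⟨X; G⟩` (with the commutator
bracket) generated by all the variables `xᵢ^g`. -/
def freeLie (G : Type*) : LieSubalgebra ℂ (FreeGAlgebra G) :=
  LieSubalgebra.lieSpan ℂ (FreeGAlgebra G) (Set.range (FreeAlgebra.ι ℂ))

/-- An algebra endomorphism of `ℂ⟨X; G⟩` is an endomorphism of the `G`-pair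
`(ℂ⟨X; G⟩, L⟨X; G⟩)` if it commutes with the action of `G` and maps `L⟨X; G⟩` into itself. -/
def IsPairEndomorphism (θ : FreeGAlgebra G →ₐ[ℂ] FreeGAlgebra G) : Prop :=
  (∀ (g : G) (f : FreeGAlgebra G), θ (gAct g f) = gAct g (θ f)) ∧
    ∀ f ∈ freeLie G, θ f ∈ freeLie G

/-- A weak `G`-ideal: a two-sided ideal of `ℂ⟨X; G⟩` invariant under all endomorphisms of the
`G`-pair `(ℂ⟨X; G⟩, L⟨X; G⟩)`. -/
def IsWeakGIdeal (I : TwoSidedIdeal (FreeGAlgebra G)) : Prop :=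
  ∀ θ : FreeGAlgebra G →ₐ[ℂ] FreeGAlgebra G, IsPairEndomorphism θ → ∀ f ∈ I, θ f ∈ I

/-- Given an action `φ` of `G` on `M₂(ℂ)`, evaluation of `G`-polynomials at `xᵢ = aᵢ`;
the variable `xᵢ^g` is sent to `g(aᵢ)`. -/
def eval (φ : G →* (M2 ≃ₐ[ℂ] M2)) (a : ℕ → M2) : FreeGAlgebra G →ₐ[ℂ] M2 :=
  FreeAlgebra.lift ℂ fun p : ℕ × G => φ p.2 (a p.1)

/-- The ideal of weak `G`-identities of the pair `(M₂(ℂ), sl₂(ℂ))`: the `G`-polynomials which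
vanish whenever the variables are replaced by elements of `sl₂(ℂ)`. -/
def weakIdentities (φ : G →* (M2 ≃ₐ[ℂ] M2)) : TwoSidedIdeal (FreeGAlgebra G) :=
  ⨅ a : ℕ → sl2, TwoSidedIdeal.ker (eval φ fun i => (a i : M2))

theorem mem_weakIdentities (φ : G →* (M2 ≃ₐ[ℂ] M2)) (f : FreeGAlgebra G) :
    f ∈ weakIdentities φ ↔ ∀ a : ℕ → M2, (∀ i, a i ∈ sl2) → eval φ a f = 0 := by
  simp only [weakIdentities, TwoSidedIdeal.mem_iInf, TwoSidedIdeal.mem_ker]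
  exact ⟨fun h a ha => h fun i => ⟨a i, ha i⟩, fun h a => h _ fun i => (a i).2⟩

/-- A set `S` of `G`-polynomials is a basis of the weak `G`-identities of `(M₂(ℂ), sl₂(ℂ))` if
the ideal of weak `G`-identities is the least weak `G`-ideal containing `S`. -/
def IsBasisOfWeakIdentities (φ : G →* (M2 ≃ₐ[ℂ] M2)) (S : Set (FreeGAlgebra G)) : Prop :=
  IsLeast {I : TwoSidedIdeal (FreeGAlgebra G) | IsWeakGIdeal I ∧ S ⊆ (I : Set (FreeGAlgebra G))}
    (weakIdentities φ)

/-- The action of the group algebra `ℂG` on `M₂(ℂ)` extending linearly the action of `G`. -/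
def groupAlgebraAct (φ : G →* (M2 ≃ₐ[ℂ] M2)) : MonoidAlgebra ℂ G →ₐ[ℂ] Module.End ℂ M2 :=
  MonoidAlgebra.lift ℂ (Module.End ℂ M2) G ((AlgEquiv.toLinearMapHom ℂ M2).comp φ)

/-- `ε` is the system of matrix units `εᵢⱼ` of the copy of `M₃(ℂ)` in `ℂG`: one has
`ℂG = J₀ ⊕ J₁` with two-sided ideals `J₀` and `J₁`, where `J₀` consists of all the elements that
annihilate `sl₂(ℂ)`, and `εᵢⱼ` is an element of `J₁` that acts on `sl₂(ℂ)` by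
`εᵢⱼ(vₖ) = δⱼₖ vᵢ`. -/
def IsEpsilon (φ : G →* (M2 ≃ₐ[ℂ] M2)) (ε : Fin 3 → Fin 3 → MonoidAlgebra ℂ G) : Prop :=
  ∃ J₀ J₁ : TwoSidedIdeal (MonoidAlgebra ℂ G),
    (∀ z, z ∈ J₀ ↔ ∀ x ∈ sl2, groupAlgebraAct φ z x = 0) ∧ IsCompl J₀ J₁ ∧
      (∀ i j, ε i j ∈ J₁) ∧
      ∀ i j k, groupAlgebraAct φ (ε i j) (v k) = if j = k then v i else 0

/-- For `z = ∑ z_g g` in `ℂG`, the `G`-polynomial `z(xᵢ) = ∑ z_g xᵢ^g`. -/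
def opVar (z : MonoidAlgebra ℂ G) (i : ℕ) : FreeGAlgebra G :=
  z.coeff.sum fun g c => c • X i g

/-- The eight families of `G`-polynomials. The indices `1, 2, 3` are written `0, 1, 2` here,
so that `i ∈ {2, 3}` becomes `i ≠ 0`, and the relation `p = q` is recorded as `p - q`. -/
inductive IsListed (ε : Fin 3 → Fin 3 → MonoidAlgebra ℂ G) : FreeGAlgebra G → Prop
  | one : IsListed ε (opVar (ε 0 0) 1 + opVar (ε 1 1) 1 + opVar (ε 2 2) 1 - X 1 1)
  | two (α β : Fin 3) : IsListed ε
      (opVar (ε 0 α) 1 * opVar (ε 0 β) 2 - opVar (ε 0 β) 2 * opVar (ε 0 α) 1)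
  | three (α i j : Fin 3) (hi : i ≠ 0) : IsListed ε
      (opVar (ε 0 α) 1 * opVar (ε i j) 2 + opVar (ε i j) 2 * opVar (ε 0 α) 1)
  | four (i j α β γ : Fin 3) (hi : i ≠ 0) (hj : j ≠ 0) (hij : i ≠ j) : IsListed ε
      (opVar (ε i α) 1 * opVar (ε j β) 2 * opVar (ε i γ) 3
        - opVar (ε 0 α) 1 * opVar (ε 0 β) 2 * opVar (ε i γ) 3)
  | five (i α β : Fin 3) (hi : i ≠ 0) : IsListed ε (opVar (ε i α) 1 * opVar (ε i β) 2)
  | six (α β : Fin 3) : IsListed ε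
      (opVar (ε 2 α) 1 * opVar (ε 1 β) 2 + opVar (ε 1 β) 2 * opVar (ε 2 α) 1
        - opVar (ε 0 α) 1 * opVar (ε 0 β) 2)
  | seven (j α β : Fin 3) (hj : j ≠ 0) : IsListed ε
      (opVar (ε 0 α) 1 * opVar (ε j β) 2 - opVar (ε 0 β) 2 * opVar (ε j α) 1)
  | eight (α β : Fin 3) : IsListed ε
      (opVar (ε 1 α) 1 * opVar (ε 2 β) 2 - opVar (ε 1 β) 2 * opVar (ε 2 α) 1)

end

end WeakGIdentities

/-! The algebra `ℂG` maps onto `End sl₂`: `G` contains a Klein four-group and an element `c`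
permuting its involutions cyclically, so `sl₂` splits into three distinct joint eigenlines cycled by
`c`, and the eigenprojections together with powers of `c` give all matrix units
(`sl2Act_surjective`). The kernel `J₀` is generated by a central idempotent `f`, so the multiples of
`1 - f` form a complement mapping isomorphically onto `End sl₂`. This yields the `εᵢⱼ`, and since
complements of two-sided ideals are unique, also their uniqueness.

For the basis, put `p = (m, j)` and `y i p = εᵢⱼ(x_m)`. At `x_m = ∑ t_(m,j) vⱼ` the element `y i p`
takes the value `t_p vᵢ`, with all `t_p` free. A word in the `y i p` thus takes the value (monomial
in `t`) × (product of the `vᵢ`). The relations 2–8 imply that the word itself is determined by these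
two data (`prod_eq_normalForm`, `normalForm_perm`). Hence in any algebra satisfying them, evaluation
of noncommutative polynomials factors linearly through the generic evaluation
(`GenericRelations.lift_eq`), and whatever vanishes generically vanishes there. Relation 1 says that
the `y i p` generate the quotient by a weak `G`-ideal containing the list, so every weak identity
dies in it. -/

namespace WeakGIdentities

noncomputable section

attribute [local instance 100] LieRing.ofAssociativeRing

/-! ### Irreducibility of `sl₂(ℂ)` as a representation of `G` -/

section

variable {G : Type*} [Group G]

/-- The three entries of a matrix which are its coordinates in the basis `v` if it is traceless. -/
def coord : Fin 3 → M2 →ₗ[ℂ] ℂ :=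
  ![Matrix.entryLinearMap ℂ ℂ 0 0, Matrix.entryLinearMap ℂ ℂ 0 1, Matrix.entryLinearMap ℂ ℂ 1 0]

theorem mem_sl2_iff (x : M2) : x ∈ sl2 ↔ x 0 0 + x 1 1 = 0 := by
  rw [← Matrix.trace_fin_two]
  exact Iff.rfl

theorem v_mem_sl2 (i : Fin 3) : v i ∈ sl2 := by
  rw [mem_sl2_iff]
  fin_cases i <;> simp [v]

theorem coord_v (i j : Fin 3) : coord i (v j) = if i = j then 1 else 0 := by
  fin_cases i <;> fin_cases j <;> simp [v, coord]

theorem sum_coord_smul_v {x : M2} (hx : x ∈ sl2) : ∑ i, coord i x • v i = x := by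
  rw [mem_sl2_iff] at hx
  ext i j
  fin_cases i <;> fin_cases j <;> simp [v, coord, Fin.sum_univ_three]
  linear_combination -hx

theorem sum_smul_v_mem_sl2 (c : Fin 3 → ℂ) : ∑ i, c i • v i ∈ sl2 :=
  sum_mem fun i _ => sl2.smul_mem (c i) (v_mem_sl2 i)

theorem coord_sum_smul_v (c : Fin 3 → ℂ) (i : Fin 3) : coord i (∑ j, c j • v j) = c i := by
  simp [map_sum, coord_v]

/-- The coordinates with respect to the basis `v` of `sl₂(ℂ)`. -/
def sl2Equiv : sl2 ≃ₗ[ℂ] (Fin 3 → ℂ) where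
  toFun x i := coord i (x : M2)
  map_add' x y := by ext i; simp
  map_smul' c x := by ext i; simp
  invFun c := ⟨∑ i, c i • v i, sum_smul_v_mem_sl2 c⟩
  left_inv x := Subtype.ext (sum_coord_smul_v x.2)
  right_inv c := funext (coord_sum_smul_v c)

theorem finrank_sl2 : Module.finrank ℂ sl2 = 3 := by
  rw [sl2Equiv.finrank_eq]; simp

/-- Algebra automorphisms preserve `sl₂(ℂ)`, which is spanned by commutators. -/
theorem algEquiv_mem_sl2 (e : M2 ≃ₐ[ℂ] M2) {x : M2} (hx : x ∈ sl2) : e x ∈ sl2 := by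
  have key : ∀ y z : M2, e (y * z - z * y) ∈ sl2 := by
    intro y z
    change Matrix.trace (e (y * z - z * y)) = 0
    rw [map_sub, map_mul, map_mul, Matrix.trace_sub, Matrix.trace_mul_comm, sub_self]
  rw [← sum_coord_smul_v hx, map_sum]
  refine sum_mem fun i _ => ?_
  rw [map_smul]
  refine sl2.smul_mem _ ?_
  fin_cases i
  · have h : v 0 = v 1 * v 2 - v 2 * v 1 := by
      ext i j; fin_cases i <;> fin_cases j <;> simp [v]
    change e (v 0) ∈ sl2
    rw [h]; exact key _ _
  · have h : v 1 = ((1 / 2 : ℂ) • v 0) * v 1 - v 1 * ((1 / 2 : ℂ) • v 0) := by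
      ext i j; fin_cases i <;> fin_cases j <;> (simp [v]; try norm_num)
    change e (v 1) ∈ sl2
    rw [h]; exact key _ _
  · have h : v 2 = v 2 * ((1 / 2 : ℂ) • v 0) - ((1 / 2 : ℂ) • v 0) * v 2 := by
      ext i j; fin_cases i <;> fin_cases j <;> (simp [v]; try norm_num)
    change e (v 2) ∈ sl2
    rw [h]; exact key _ _

/-- The representation of `G` on `sl₂(ℂ)`. -/
def sl2Rep (φ : G →* (M2 ≃ₐ[ℂ] M2)) : G →* Module.End ℂ sl2 where
  toFun g :=
    { toFun := fun x => ⟨φ g x, algEquiv_mem_sl2 (φ g) x.2⟩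
      map_add' := fun x y => by ext1; simp
      map_smul' := fun c x => by ext1; simp }
  map_one' := by ext1 x; ext1; simp
  map_mul' g h := by ext1 x; ext1; simp

theorem coe_sl2Rep_apply (φ : G →* (M2 ≃ₐ[ℂ] M2)) (g : G) (x : sl2) :
    (sl2Rep φ g x : M2) = φ g x := rfl

/-- The representation of `ℂG` on `sl₂(ℂ)`. -/
def sl2Act (φ : G →* (M2 ≃ₐ[ℂ] M2)) : MonoidAlgebra ℂ G →ₐ[ℂ] Module.End ℂ sl2 :=
  MonoidAlgebra.lift ℂ (Module.End ℂ sl2) G (sl2Rep φ)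

theorem groupAlgebraAct_of (φ : G →* (M2 ≃ₐ[ℂ] M2)) (g : G) (x : M2) :
    groupAlgebraAct φ (MonoidAlgebra.of ℂ G g) x = φ g x := by
  simp [groupAlgebraAct]

theorem coe_sl2Act_apply (φ : G →* (M2 ≃ₐ[ℂ] M2)) (z : MonoidAlgebra ℂ G) (x : sl2) :
    (sl2Act φ z x : M2) = groupAlgebraAct φ z x := by
  induction z using MonoidAlgebra.induction_on with
  | of g =>
    rw [groupAlgebraAct_of, ← coe_sl2Rep_apply]
    simp [sl2Act]
  | add a b ha hb => simp [ha, hb]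
  | smul r a ha => simp [ha]

theorem groupAlgebraAct_mem_sl2 (φ : G →* (M2 ≃ₐ[ℂ] M2)) (z : MonoidAlgebra ℂ G) {x : M2}
    (hx : x ∈ sl2) : groupAlgebraAct φ z x ∈ sl2 := by
  rw [← coe_sl2Act_apply φ z ⟨x, hx⟩]
  exact (sl2Act φ z ⟨x, hx⟩).2

/-- Algebra automorphisms fix the scalars, and `M₂ = ℂ ⊕ sl₂`. -/
theorem sl2Rep_injective {φ : G →* (M2 ≃ₐ[ℂ] M2)} (hφ : Function.Injective φ) :
    Function.Injective (sl2Rep φ) := by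
  intro g h hgh
  apply hφ
  ext1 x
  have hs : x - (x.trace / 2) • (1 : M2) ∈ sl2 := by
    rw [mem_sl2_iff]
    simp [Matrix.trace_fin_two]
    ring
  have h1 := congrArg Subtype.val (LinearMap.congr_fun hgh ⟨_, hs⟩)
  simpa [coe_sl2Rep_apply] using h1

/-- A subalgebra of `End V`, `dim V = 3`, which contains commuting involutions `a ≠ 1`, `b` and an
invertible operator that permutes `a`, `b`, `a * b` cyclically is everything. -/
theorem subalgebra_eq_top_of_klein_four {V : Type*} [AddCommGroup V] [Module ℂ V]
    (hV : Module.finrank ℂ V = 3) (S : Subalgebra ℂ (Module.End ℂ V)) {a b c c' : Module.End ℂ V}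
    (ha : a ∈ S) (hb : b ∈ S) (hc : c ∈ S) (hc' : c' ∈ S) (haa : a * a = 1) (hbb : b * b = 1)
    (hab : a * b = b * a) (hcc' : c * c' = 1) (hc'c : c' * c = 1) (hca : c * a = b * c)
    (hcb : c * b = a * b * c) (ha1 : a ≠ 1) : S = ⊤ := by
  have hbab : b * a * b = a := by rw [← hab, mul_assoc, hbb, mul_one]
  have haba : a * b * a = b := by rw [hab, mul_assoc, haa, mul_one]
  -- Four times the projections onto the joint eigenspaces of `(a, b)` for the signs `(1, -1)`,
  -- `(-1, 1)`, `(-1, -1)`; conjugation by `c` takes each to the next.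
  set P : Fin 3 → Module.End ℂ V := ![(1 + a) * (1 - b), (1 - a) * (1 + b), (1 - a) * (1 - b)]
    with hP
  have hPS : ∀ i, P i ∈ S := by
    intro i
    fin_cases i
    · exact S.mul_mem (S.add_mem S.one_mem ha) (S.sub_mem S.one_mem hb)
    · exact S.mul_mem (S.sub_mem S.one_mem ha) (S.add_mem S.one_mem hb)
    · exact S.mul_mem (S.sub_mem S.one_mem ha) (S.sub_mem S.one_mem hb)
  have hc0 : c * P 0 = P 1 * c := by
    change c * ((1 + a) * (1 - b)) = (1 - a) * (1 + b) * c
    have e1 : c * ((1 + a) * (1 - b)) = c - c * b + c * a - c * a * b := by noncomm_ring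
    rw [e1, hca, mul_assoc b c b, hcb, ← mul_assoc b, ← mul_assoc b, hbab]
    noncomm_ring
  have hc1 : c * P 1 = P 2 * c := by
    change c * ((1 - a) * (1 + b)) = (1 - a) * (1 - b) * c
    have e1 : c * ((1 - a) * (1 + b)) = c + c * b - c * a - c * a * b := by noncomm_ring
    rw [e1, hca, mul_assoc b c b, hcb, ← mul_assoc b, ← mul_assoc b, hbab]
    noncomm_ring
  have hPP : ∀ i j, P i * P j = if i = j then (4 : ℂ) • P i else 0 := by
    have e1 : (1 + a) * (1 - a) = 0 := by
      have : (1 + a) * (1 - a) = 1 - a * a := by noncomm_ring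
      rw [this, haa, sub_self]
    have e2 : (1 + b) * (1 - b) = 0 := by
      have : (1 + b) * (1 - b) = 1 - b * b := by noncomm_ring
      rw [this, hbb, sub_self]
    have e1' : (1 - a) * (1 + a) = 0 := by
      have : (1 - a) * (1 + a) = 1 - a * a := by noncomm_ring
      rw [this, haa, sub_self]
    have e2' : (1 - b) * (1 + b) = 0 := by
      have : (1 - b) * (1 + b) = 1 - b * b := by noncomm_ring
      rw [this, hbb, sub_self]
    have e3 : (1 + a) * (1 + a) = (2 : ℂ) • (1 + a) := by
      have : (1 + a) * (1 + a) = 1 + a + a + a * a := by noncomm_ring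
      rw [this, haa, two_smul]; abel
    have e4 : (1 - a) * (1 - a) = (2 : ℂ) • (1 - a) := by
      have : (1 - a) * (1 - a) = 1 - a - a + a * a := by noncomm_ring
      rw [this, haa, two_smul]; abel
    have e5 : (1 + b) * (1 + b) = (2 : ℂ) • (1 + b) := by
      have : (1 + b) * (1 + b) = 1 + b + b + b * b := by noncomm_ring
      rw [this, hbb, two_smul]; abel
    have e6 : (1 - b) * (1 - b) = (2 : ℂ) • (1 - b) := by
      have : (1 - b) * (1 - b) = 1 - b - b + b * b := by noncomm_ring
      rw [this, hbb, two_smul]; abel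
    have hcomm : Commute a b := hab
    have c1 : Commute (1 - b) (1 + a) :=
      ((Commute.one_left _).sub_left ((Commute.one_right b).add_right hcomm.symm))
    have c2 : Commute (1 - b) (1 - a) :=
      ((Commute.one_left _).sub_left ((Commute.one_right b).sub_right hcomm.symm))
    have c3 : Commute (1 + b) (1 + a) :=
      ((Commute.one_left _).add_left ((Commute.one_right b).add_right hcomm.symm))
    have c4 : Commute (1 + b) (1 - a) :=
      ((Commute.one_left _).add_left ((Commute.one_right b).sub_right hcomm.symm))
    have h4 : (4 : ℂ) = 2 * 2 := by norm_num
    intro i j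
    fin_cases i <;> fin_cases j <;> simp [hP] <;>
      simp only [c1.mul_mul_mul_comm, c2.mul_mul_mul_comm, c3.mul_mul_mul_comm,
        c4.mul_mul_mul_comm, e1, e2, e1', e2', e3, e4, e5, e6, zero_mul, mul_zero, smul_mul_smul, h4]
  -- The `P i` are conjugate, so if one vanishes all do; but `P 1 + P 2 = 2(1 - a)` is nonzero.
  obtain ⟨u, hu⟩ : ∃ u, P 0 u ≠ 0 := by
    by_contra! h
    have h0 : P 0 = 0 := LinearMap.ext h
    have h1 : P 1 = 0 := by
      rw [← mul_one (P 1), ← hcc', ← mul_assoc, ← hc0, h0, mul_zero, zero_mul]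
    have h2 : P 2 = 0 := by
      rw [← mul_one (P 2), ← hcc', ← mul_assoc, ← hc1, h1, mul_zero, zero_mul]
    have h3 : (2 : ℂ) • (1 - a) = 0 := by
      have : (2 : ℂ) • (1 - a) = P 1 + P 2 := by
        change _ = (1 - a) * (1 + b) + (1 - a) * (1 - b)
        rw [two_smul]; noncomm_ring
      rw [this, h1, h2, add_zero]
    have h4 := (smul_eq_zero.1 h3).resolve_left two_ne_zero
    exact ha1 (sub_eq_zero.1 h4).symm
  set C : Fin 3 → Module.End ℂ V := ![1, c, c * c] with hC
  set C' : Fin 3 → Module.End ℂ V := ![1, c', c' * c'] with hC'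
  have hCS : ∀ i, C i ∈ S := by
    intro i
    fin_cases i
    exacts [S.one_mem, hc, S.mul_mem hc hc]
  have hCS' : ∀ i, C' i ∈ S := by
    intro i
    fin_cases i
    exacts [S.one_mem, hc', S.mul_mem hc' hc']
  have hCP : ∀ i, C i * P 0 = P i * C i := by
    intro i
    fin_cases i
    · simp [hC]
    · exact hc0
    · change c * c * P 0 = P 2 * (c * c)
      rw [mul_assoc, hc0, ← mul_assoc, hc1, mul_assoc]
  have hCC : ∀ i, C' i * C i = 1 := by
    intro i
    fin_cases i
    · simp [hC, hC']
    · exact hc'c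
    · change c' * c' * (c * c) = 1
      rw [mul_assoc, ← mul_assoc c' c c, hc'c, one_mul, hc'c]
  -- One nonzero vector in each of the three eigenspaces; by dimension they form a basis.
  set w : Fin 3 → V := fun i => C i (P 0 u) with hw
  have hPw : ∀ i j, P i (w j) = if i = j then (4 : ℂ) • w j else 0 := by
    intro i j
    have : P i (w j) = (P i * P j) (C j u) := by
      change P i ((C j * P 0) u) = _
      rw [hCP]; rfl
    rw [this, hPP]
    split_ifs with h
    · subst h
      change (4 : ℂ) • (P i * C i) u = _
      rw [← hCP]; rfl
    · rfl
  have hC'w : ∀ i, C' i (w i) = P 0 u := by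
    intro i
    change (C' i * C i) (P 0 u) = _
    rw [hCC]; rfl
  have hw0 : ∀ i, w i ≠ 0 := by
    intro i h
    apply hu
    rw [← hC'w i, h, map_zero]
  have hli : LinearIndependent ℂ w := by
    rw [Fintype.linearIndependent_iff]
    intro g hg i
    have := congrArg (P i) hg
    simp only [map_sum, map_smul, hPw, map_zero] at this
    simpa [hw0 i] using this
  let B := basisOfLinearIndependentOfCardEqFinrank hli (by simp [hV])
  have hB : ∀ i, B i = w i := fun i => by simp [B]
  rw [eq_top_iff]
  intro T _
  -- `C i * C' j * P j` is four times the matrix unit taking `w j` to `w i`, whence the division by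
  -- 4.
  have hT : T = ∑ i, ∑ j, (B.repr (T (w j)) i / 4) • (C i * C' j * P j) := by
    refine B.ext fun k => ?_
    have : ∀ i j, (C i * C' j * P j) (w k) = if j = k then (4 : ℂ) • w i else 0 := by
      intro i j
      change C i (C' j (P j (w k))) = _
      rw [hPw]
      split_ifs with h
      · subst h
        rw [map_smul, map_smul, hC'w]
      · rw [map_zero, map_zero]
    rw [hB]
    simp only [LinearMap.sum_apply, LinearMap.smul_apply, this]
    conv_lhs => rw [← B.sum_repr (T (w k))]
    refine Finset.sum_congr rfl fun i _ => ?_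
    rw [hB]
    simp [smul_smul]
  rw [hT]
  exact S.sum_mem fun i _ => S.sum_mem fun j _ =>
    S.smul_mem (S.mul_mem (S.mul_mem (hCS i) (hCS' j)) (hPS j)) _

/-- The groups `A₄`, `A₅`, `S₄` contain a Klein four-group whose involutions are permuted
cyclically by conjugation. -/
theorem exists_klein_four
    (hG : Nonempty (G ≃* alternatingGroup (Fin 4)) ∨ Nonempty (G ≃* alternatingGroup (Fin 5)) ∨
      Nonempty (G ≃* Equiv.Perm (Fin 4))) :
    ∃ a b c : G, a * a = 1 ∧ b * b = 1 ∧ a * b = b * a ∧ c * a = b * c ∧ c * b = a * b * c ∧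
      a ≠ 1 := by
  have transfer : ∀ {H : Type} [Group H] (_ : G ≃* H), (∃ a b c : H, a * a = 1 ∧ b * b = 1 ∧
      a * b = b * a ∧ c * a = b * c ∧ c * b = a * b * c ∧ a ≠ 1) → ∃ a b c : G, a * a = 1 ∧
      b * b = 1 ∧ a * b = b * a ∧ c * a = b * c ∧ c * b = a * b * c ∧ a ≠ 1 := by
    rintro H _ e ⟨a, b, c, h1, h2, h3, h4, h5, h6⟩
    refine ⟨e.symm a, e.symm b, e.symm c, ?_, ?_, ?_, ?_, ?_, ?_⟩
    · rw [← map_mul, h1, map_one]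
    · rw [← map_mul, h2, map_one]
    · rw [← map_mul, h3, map_mul]
    · rw [← map_mul, h4, map_mul]
    · rw [← map_mul, h5, map_mul, map_mul]
    · simpa using h6
  rcases hG with ⟨⟨e⟩⟩ | ⟨⟨e⟩⟩ | ⟨⟨e⟩⟩
  -- The double transpositions `(01)(23)` and `(02)(13)`, with the 3-cycle `1 ↦ 2 ↦ 3 ↦ 1`
  -- conjugating the first into the second and the second into their product.
  · refine transfer e ⟨
      ⟨Equiv.swap 0 1 * Equiv.swap 2 3, Equiv.Perm.mem_alternatingGroup.2 (by decide)⟩,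
      ⟨Equiv.swap 0 2 * Equiv.swap 1 3, Equiv.Perm.mem_alternatingGroup.2 (by decide)⟩,
      ⟨Equiv.swap 1 2 * Equiv.swap 2 3, Equiv.Perm.mem_alternatingGroup.2 (by decide)⟩, ?_⟩
    decide
  · refine transfer e ⟨
      ⟨Equiv.swap 0 1 * Equiv.swap 2 3, Equiv.Perm.mem_alternatingGroup.2 (by decide)⟩,
      ⟨Equiv.swap 0 2 * Equiv.swap 1 3, Equiv.Perm.mem_alternatingGroup.2 (by decide)⟩,
      ⟨Equiv.swap 1 2 * Equiv.swap 2 3, Equiv.Perm.mem_alternatingGroup.2 (by decide)⟩, ?_⟩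
    decide
  · refine transfer e ⟨Equiv.swap 0 1 * Equiv.swap 2 3, Equiv.swap 0 2 * Equiv.swap 1 3,
      Equiv.swap 1 2 * Equiv.swap 2 3, ?_⟩
    decide

theorem finite_of_mulEquiv
    (hG : Nonempty (G ≃* alternatingGroup (Fin 4)) ∨ Nonempty (G ≃* alternatingGroup (Fin 5)) ∨
      Nonempty (G ≃* Equiv.Perm (Fin 4))) : Finite G := by
  rcases hG with ⟨⟨e⟩⟩ | ⟨⟨e⟩⟩ | ⟨⟨e⟩⟩ <;> exact Finite.of_equiv _ e.symm.toEquiv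

theorem sl2Act_surjective
    (hG : Nonempty (G ≃* alternatingGroup (Fin 4)) ∨ Nonempty (G ≃* alternatingGroup (Fin 5)) ∨
      Nonempty (G ≃* Equiv.Perm (Fin 4)))
    {φ : G →* (M2 ≃ₐ[ℂ] M2)} (hφ : Function.Injective φ) : Function.Surjective (sl2Act φ) := by
  obtain ⟨a, b, c, haa, hbb, hab, hca, hcb, ha1⟩ := exists_klein_four hG
  rw [← AlgHom.range_eq_top]
  have hmem : ∀ g : G, sl2Rep φ g ∈ (sl2Act φ).range := fun g =>
    ⟨MonoidAlgebra.of ℂ G g, by simp [sl2Act]⟩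
  refine subalgebra_eq_top_of_klein_four finrank_sl2 _ (hmem a) (hmem b) (hmem c) (hmem c⁻¹)
    ?_ ?_ ?_ ?_ ?_ ?_ ?_ ?_
  · rw [← map_mul, haa, map_one]
  · rw [← map_mul, hbb, map_one]
  · rw [← map_mul, hab, map_mul]
  · rw [← map_mul, mul_inv_cancel, map_one]
  · rw [← map_mul, inv_mul_cancel, map_one]
  · rw [← map_mul, hca, map_mul]
  · rw [← map_mul, hcb, map_mul, map_mul]
  · rw [← map_one (sl2Rep φ)]
    exact (sl2Rep_injective hφ).ne ha1

end

/-! ### Existence, uniqueness and multiplication of the matrix units in `ℂG` -/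

section

variable {G : Type*} [Group G]

/-- A left ideal of a semisimple ring that is also a right ideal is generated by a central
idempotent. -/
theorem exists_central_idempotent {R : Type*} [Ring R] [IsSemisimpleRing R] (I : TwoSidedIdeal R) :
    ∃ f ∈ I, (∀ x ∈ I, x * f = x) ∧ ∀ x, x * f = f * x := by
  have key : ∀ J : Ideal R, ∃ e ∈ J, ∀ x ∈ J, x * e = x := by
    intro J
    obtain ⟨e, he, rfl⟩ := IsSemisimpleRing.ideal_eq_span_idempotent J
    refine ⟨e, Ideal.mem_span_singleton_self e, fun x hx => ?_⟩
    obtain ⟨y, rfl⟩ := Ideal.mem_span_singleton'.1 hx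
    rw [mul_assoc, he.eq]
  obtain ⟨f, hfI, hf⟩ := key (TwoSidedIdeal.asIdeal I)
  rw [TwoSidedIdeal.mem_asIdeal] at hfI
  have hf' : ∀ x ∈ I, x * f = x := fun x hx => hf x (TwoSidedIdeal.mem_asIdeal.2 hx)
  -- So far `f` is only a right identity of `I`. The defect `y = x - f * x` lies in `I` and is
  -- killed by `I` from the left. A right identity `e = r * y` of the left ideal generated by `y`
  -- gives `y = (y * r) * y = 0`.
  have hleft : ∀ x ∈ I, f * x = x := by
    intro x hx
    obtain ⟨e, he, hxe⟩ := key (Ideal.span {x - f * x})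
    have hann : ∀ z ∈ I, z * (x - f * x) = 0 := fun z hz => by
      rw [mul_sub, ← mul_assoc, hf' z hz, sub_self]
    have hyI : x - f * x ∈ I := I.sub_mem hx (I.mul_mem_left f x hx)
    obtain ⟨r, rfl⟩ := Ideal.mem_span_singleton'.1 he
    have := hxe _ (Ideal.mem_span_singleton_self (x - f * x))
    rw [← mul_assoc, hann _ (I.mul_mem_right _ _ hyI)] at this
    exact (sub_eq_zero.1 this.symm).symm
  refine ⟨f, hfI, hf', fun x => ?_⟩
  rw [← hleft (x * f) (I.mul_mem_left x f hfI), ← mul_assoc, hf' _ (I.mul_mem_right f x hfI)]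

/-- The operator `vₖ ↦ δⱼₖ vᵢ` on `sl₂(ℂ)`. -/
def sl2MatrixUnit (i j : Fin 3) : Module.End ℂ sl2 where
  toFun x := coord j (x : M2) • ⟨v i, v_mem_sl2 i⟩
  map_add' x y := by simp [add_smul]
  map_smul' c x := by simp [mul_smul]

theorem groupAlgebraAct_eq_zero_iff (φ : G →* (M2 ≃ₐ[ℂ] M2)) (z : MonoidAlgebra ℂ G) :
    (∀ x ∈ sl2, groupAlgebraAct φ z x = 0) ↔ sl2Act φ z = 0 := by
  constructor
  · intro h
    ext1 x
    exact Subtype.ext ((coe_sl2Act_apply φ z x).trans (h x x.2))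
  · intro h x hx
    rw [← coe_sl2Act_apply φ z ⟨x, hx⟩, h]
    rfl

theorem exists_isEpsilon
    (hG : Nonempty (G ≃* alternatingGroup (Fin 4)) ∨ Nonempty (G ≃* alternatingGroup (Fin 5)) ∨
      Nonempty (G ≃* Equiv.Perm (Fin 4)))
    {φ : G →* (M2 ≃ₐ[ℂ] M2)} (hφ : Function.Injective φ) : ∃ ε, IsEpsilon φ ε := by
  have := finite_of_mulEquiv hG
  -- The hypothesis of Maschke's theorem, which makes `ℂG` semisimple.
  have : NeZero (Nat.card G : ℂ) := ⟨Nat.cast_ne_zero.2 Nat.card_pos.ne'⟩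
  obtain ⟨f, hfJ, hf, hfc⟩ := exists_central_idempotent (TwoSidedIdeal.ker (sl2Act φ))
  -- The complement is the annihilator of `f`; centrality of `f` makes it two-sided.
  let J₁ : TwoSidedIdeal (MonoidAlgebra ℂ G) := TwoSidedIdeal.mk' {z | z * f = 0}
    (zero_mul f)
    (fun {x y} hx hy => by
      simp only [Set.mem_ofPred_eq] at hx hy ⊢
      rw [add_mul, hx, hy, add_zero])
    (fun {x} hx => by
      simp only [Set.mem_ofPred_eq] at hx ⊢
      rw [neg_mul, hx, neg_zero])
    (fun {x y} hy => by
      simp only [Set.mem_ofPred_eq] at hy ⊢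
      rw [mul_assoc, hy, mul_zero])
    (fun {x y} hx => by
      simp only [Set.mem_ofPred_eq] at hx ⊢
      rw [mul_assoc, hfc, ← mul_assoc, hx, zero_mul])
  have hJ₁ : ∀ z, z ∈ J₁ ↔ z * f = 0 := fun z => TwoSidedIdeal.mem_mk' _ _ _ _ _ _ z
  have hker : ∀ z, z ∈ TwoSidedIdeal.ker (sl2Act φ) ↔ sl2Act φ z = 0 :=
    fun z => TwoSidedIdeal.mem_ker _
  choose z hz using fun T => sl2Act_surjective hG hφ T
  have h1f : ∀ y : MonoidAlgebra ℂ G, y * (1 - f) ∈ J₁ := fun y => by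
    rw [hJ₁, mul_assoc, sub_mul, one_mul, hf f hfJ, sub_self, mul_zero]
  -- Since `f` acts as zero, the factor `1 - f` moves an arbitrary preimage into `J₁` without
  -- changing its action.
  refine ⟨fun i j => z (sl2MatrixUnit i j) * (1 - f), TwoSidedIdeal.ker (sl2Act φ), J₁,
    fun y => ?_, ⟨?_, ?_⟩, fun i j => h1f _, fun i j k => ?_⟩
  · rw [groupAlgebraAct_eq_zero_iff, hker]
  · rw [disjoint_iff_inf_le]
    intro x hx
    obtain ⟨hx0, hx1⟩ := (TwoSidedIdeal.mem_inf _).1 hx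
    rw [TwoSidedIdeal.mem_bot, ← hf x hx0]
    exact (hJ₁ x).1 hx1
  · rw [codisjoint_iff, ← TwoSidedIdeal.one_mem_iff, TwoSidedIdeal.mem_sup]
    exact ⟨f, hfJ, 1 - f, by simpa using h1f 1, by abel⟩
  · have hv := coe_sl2Act_apply φ (z (sl2MatrixUnit i j) * (1 - f)) ⟨v k, v_mem_sl2 k⟩
    rw [← hv, map_mul, map_sub, map_one, (hker f).1 hfJ, sub_zero, mul_one, hz]
    change coord j (v k) • v i = _
    rw [coord_v]
    simp

theorem groupAlgebraAct_eq_of_forall_v {φ : G →* (M2 ≃ₐ[ℂ] M2)} {z w : MonoidAlgebra ℂ G}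
    (h : ∀ k, groupAlgebraAct φ z (v k) = groupAlgebraAct φ w (v k)) {x : M2} (hx : x ∈ sl2) :
    groupAlgebraAct φ z x = groupAlgebraAct φ w x := by
  rw [← sum_coord_smul_v hx]
  simp only [map_sum, map_smul, h]

/-- An element of the complement of the annihilator of `sl₂(ℂ)` is determined by its action. -/
theorem eq_of_groupAlgebraAct_eq {φ : G →* (M2 ≃ₐ[ℂ] M2)}
    {J₀ J₁ : TwoSidedIdeal (MonoidAlgebra ℂ G)}
    (hJ₀ : ∀ z, z ∈ J₀ ↔ ∀ x ∈ sl2, groupAlgebraAct φ z x = 0) (hJ : IsCompl J₀ J₁)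
    {z w : MonoidAlgebra ℂ G} (hz : z ∈ J₁) (hw : w ∈ J₁)
    (h : ∀ k, groupAlgebraAct φ z (v k) = groupAlgebraAct φ w (v k)) : z = w := by
  have h0 : z - w ∈ J₀ := (hJ₀ _).2 fun x hx => by
    rw [map_sub, LinearMap.sub_apply, groupAlgebraAct_eq_of_forall_v h hx, sub_self]
  have := hJ.disjoint.le_bot ((TwoSidedIdeal.mem_inf _).2 ⟨h0, J₁.sub_mem hz hw⟩)
  rw [TwoSidedIdeal.mem_bot] at this
  exact sub_eq_zero.1 this

theorem mul_eq_zero_of_isCompl {R : Type*} [Ring R] {I J : TwoSidedIdeal R} (h : IsCompl I J)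
    {x y : R} (hx : x ∈ I) (hy : y ∈ J) : x * y = 0 := by
  have := h.disjoint.le_bot
    ((TwoSidedIdeal.mem_inf _).2 ⟨I.mul_mem_right x y hx, J.mul_mem_left x y hy⟩)
  rwa [TwoSidedIdeal.mem_bot] at this

/-- The complement of a two-sided ideal is contained in any other complement. -/
theorem le_of_isCompl {R : Type*} [Ring R] {I J K : TwoSidedIdeal R} (hJ : IsCompl I J)
    (hK : IsCompl I K) : J ≤ K := by
  intro x hx
  have h1 : (1 : R) ∈ I ⊔ K := by rw [hK.sup_eq_top]; trivial
  obtain ⟨a, ha, b, hb, hab⟩ := TwoSidedIdeal.mem_sup.1 h1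
  rw [← one_mul x, ← hab, add_mul, mul_eq_zero_of_isCompl hJ ha hx, zero_add]
  exact K.mul_mem_right _ _ hb

theorem isEpsilon_unique {φ : G →* (M2 ≃ₐ[ℂ] M2)} {ε ε' : Fin 3 → Fin 3 → MonoidAlgebra ℂ G}
    (h : IsEpsilon φ ε) (h' : IsEpsilon φ ε') : ε = ε' := by
  obtain ⟨J₀, J₁, hJ₀, hJ, hε, hεv⟩ := h
  obtain ⟨J₀', J₁', hJ₀', hJ', hε', hεv'⟩ := h'
  obtain rfl : J₀ = J₀' := TwoSidedIdeal.ext fun z => (hJ₀ z).trans (hJ₀' z).symm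
  ext1 i
  ext1 j
  refine eq_of_groupAlgebraAct_eq hJ₀ hJ (hε i j) (le_of_isCompl hJ' hJ (hε' i j)) fun k => ?_
  rw [hεv, hεv']

namespace IsEpsilon

variable {φ : G →* (M2 ≃ₐ[ℂ] M2)} {ε : Fin 3 → Fin 3 → MonoidAlgebra ℂ G}

theorem apply (h : IsEpsilon φ ε) (i j : Fin 3) {x : M2} (hx : x ∈ sl2) :
    groupAlgebraAct φ (ε i j) x = coord j x • v i := by
  obtain ⟨_, _, _, _, _, hεv⟩ := h
  conv_lhs => rw [← sum_coord_smul_v hx]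
  simp [map_sum, hεv]

theorem mul_eq (h : IsEpsilon φ ε) (i j k l : Fin 3) :
    ε i j * ε k l = if j = k then ε i l else 0 := by
  obtain ⟨J₀, J₁, hJ₀, hJ, hε, hεv⟩ := h
  refine eq_of_groupAlgebraAct_eq hJ₀ hJ (J₁.mul_mem_left _ _ (hε k l)) ?_ fun m => ?_
  · split_ifs
    exacts [hε i l, J₁.zero_mem]
  · rw [map_mul, Module.End.mul_apply, hεv]
    by_cases hlm : l = m <;> by_cases hjk : j = k <;> simp [hlm, hjk, hεv]

/-- Multiplication by `ε₁₁ + ε₂₂ + ε₃₃` is the projection of `ℂG` onto the span of the matrix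
units. -/
theorem sum_mul_eq (h : IsEpsilon φ ε) (z : MonoidAlgebra ℂ G) :
    (ε 0 0 + ε 1 1 + ε 2 2) * z =
      ∑ i, ∑ j, coord i (groupAlgebraAct φ z (v j)) • ε i j := by
  have happly := fun (i j : Fin 3) {x : M2} (hx : x ∈ sl2) => h.apply i j hx
  obtain ⟨J₀, J₁, hJ₀, hJ, hε, hεv⟩ := h
  have hsmul : ∀ (c : ℂ) (i j : Fin 3), c • ε i j ∈ J₁ := fun c i j => by
    rw [← one_mul (ε i j), ← smul_mul_assoc]
    exact J₁.mul_mem_left _ _ (hε i j)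
  refine eq_of_groupAlgebraAct_eq hJ₀ hJ (J₁.mul_mem_right _ _
    (J₁.add_mem (J₁.add_mem (hε 0 0) (hε 1 1)) (hε 2 2)))
    (sum_mem fun i _ => sum_mem fun j _ => hsmul _ i j) fun k => ?_
  have hz := groupAlgebraAct_mem_sl2 φ z (v_mem_sl2 k)
  rw [map_mul, Module.End.mul_apply]
  simp only [map_add, LinearMap.add_apply, happly _ _ hz]
  rw [← Fin.sum_univ_three (f := fun i => coord i (groupAlgebraAct φ z (v k)) • v i)]
  simp [map_sum, hεv]

end IsEpsilon

end

/-! ### Normal forms of words modulo the relations -/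

section

/-- The relations satisfied by the elements `t_p • vᵢ` of `M₂(ℂ[t_p])`. -/
structure GenericRelations {P Q : Type*} [Ring Q] (y : Fin 3 → P → Q) : Prop where
  comm : ∀ p q, y 0 p * y 0 q = y 0 q * y 0 p
  anticomm : ∀ i, i ≠ 0 → ∀ p q, y i p * y 0 q = -(y 0 q * y i p)
  triple : ∀ i j, i ≠ 0 → j ≠ 0 → i ≠ j → ∀ p q r,
    y i p * y j q * y i r = y 0 p * y 0 q * y i r
  sq : ∀ i, i ≠ 0 → ∀ p q, y i p * y i q = 0
  add : ∀ p q, y 2 p * y 1 q + y 1 q * y 2 p = y 0 p * y 0 q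
  swap_zero : ∀ j, j ≠ 0 → ∀ p q, y 0 p * y j q = y 0 q * y j p
  swap : ∀ p q, y 1 p * y 2 q = y 1 q * y 2 p

/-- The right side of `add` is symmetric in `p, q` by `comm`, and one summand on the left is
symmetric by `swap`, so the other is too. -/
theorem GenericRelations.swap_two_one {P Q : Type*} [Ring Q] {y : Fin 3 → P → Q}
    (h : GenericRelations y) (p q : P) : y 2 p * y 1 q = y 2 q * y 1 p := by
  have h1 := h.add p q
  rw [h.comm, ← h.add q p, h.swap q p] at h1
  exact add_right_cancel h1

variable {P Q : Type*} [Ring Q] [Algebra ℂ Q]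

/-- The linear map that sends the value `vᵢ ⋯ vⱼ` of a word in the letters `vᵢ` to the value of the
corresponding word in the letters `y i p`, where the indices `p` are given by a list. -/
def normalForm (y : Fin 3 → P → Q) : List P → M2 →ₗ[ℂ] Q
  | [] => (Matrix.entryLinearMap ℂ ℂ 0 0).smulRight 1
  | [p] => (Matrix.entryLinearMap ℂ ℂ 0 0).smulRight (y 0 p) +
      (Matrix.entryLinearMap ℂ ℂ 0 1).smulRight (y 1 p) +
      (Matrix.entryLinearMap ℂ ℂ 1 0).smulRight (y 2 p)
  -- The matrix units are `v₂v₃`, `v₃v₂`, `v₁v₂` and `-v₁v₃` in one-based numbering; the last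
  -- explains the minus sign.
  | [p, q] => (Matrix.entryLinearMap ℂ ℂ 0 0).smulRight (y 1 p * y 2 q) +
      (Matrix.entryLinearMap ℂ ℂ 1 1).smulRight (y 2 p * y 1 q) +
      (Matrix.entryLinearMap ℂ ℂ 0 1).smulRight (y 0 p * y 1 q) -
      (Matrix.entryLinearMap ℂ ℂ 1 0).smulRight (y 0 p * y 2 q)
  -- As `v 0 * v 0 = 1`, a leading letter `y 0 p` can be split off whatever the matrix is.
  | p :: q :: r :: l => LinearMap.mulLeft ℂ (y 0 p) ∘ₗ normalForm y (q :: r :: l) ∘ₗ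
      LinearMap.mulLeft ℂ (v 0)

section

variable (y : Fin 3 → P → Q)

theorem normalForm_nil (m : M2) : normalForm y [] m = m 0 0 • 1 := by
  simp [normalForm]

theorem normalForm_singleton (p : P) (m : M2) :
    normalForm y [p] m = m 0 0 • y 0 p + m 0 1 • y 1 p + m 1 0 • y 2 p := by
  simp [normalForm]

theorem normalForm_pair (p q : P) (m : M2) :
    normalForm y [p, q] m = m 0 0 • (y 1 p * y 2 q) + m 1 1 • (y 2 p * y 1 q) +
      m 0 1 • (y 0 p * y 1 q) - m 1 0 • (y 0 p * y 2 q) := by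
  simp [normalForm]

theorem normalForm_cons (p : P) {l : List P} (hl : 2 ≤ l.length) (m : M2) :
    normalForm y (p :: l) m = y 0 p * normalForm y l (v 0 * m) := by
  match l, hl with
  | q :: r :: l, _ => simp [normalForm]

end

theorem v_zero_mul_self : v 0 * v 0 = 1 := by
  ext i j; fin_cases i <;> fin_cases j <;> simp [v]

theorem v_zero_mul (i : Fin 3) (hi : i ≠ 0) : v 0 * v i = -(v i * v 0) := by
  ext k l
  fin_cases i
  · exact absurd rfl hi
  all_goals fin_cases k <;> fin_cases l <;> simp [v]

namespace GenericRelations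

variable {y : Fin 3 → P → Q}

theorem normalForm_swap (h : GenericRelations y) (p q : P) (l : List P) :
    normalForm y (p :: q :: l) = normalForm y (q :: p :: l) := by
  ext1 m
  match l with
  | [] => rw [normalForm_pair, normalForm_pair, h.swap p q, h.swap_two_one p q,
      h.swap_zero 1 (by decide) p q, h.swap_zero 2 (by decide) p q]
  | [r] =>
    rw [normalForm_cons y p (l := [q, r]) (by simp), normalForm_cons y q (l := [p, r]) (by simp),
      normalForm_pair, normalForm_pair]
    simp only [mul_add, mul_sub, mul_smul_comm, ← mul_assoc, h.swap_zero 1 (by decide) p q,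
      h.swap_zero 2 (by decide) p q, h.comm p q]
  | r :: s :: l =>
    rw [normalForm_cons y p (l := q :: r :: s :: l) (by simp),
      normalForm_cons y q (l := r :: s :: l) (by simp),
      normalForm_cons y q (l := p :: r :: s :: l) (by simp),
      normalForm_cons y p (l := r :: s :: l) (by simp), ← mul_assoc (y 0 p), h.comm,
      mul_assoc]

theorem normalForm_perm (h : GenericRelations y) {l l' : List P} (hl : l.Perm l') :
    normalForm y l = normalForm y l' := by
  induction hl with
  | nil => rfl
  | @cons x l₁ l₂ hp ih =>
    by_cases h2 : 2 ≤ l₁.length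
    · ext1 m
      rw [normalForm_cons y x h2, normalForm_cons y x (hp.length_eq ▸ h2), ih]
    · have : l₁ = l₂ := by
        match l₁, h2 with
        | [], _ => exact (List.nil_perm.1 hp).symm
        | [a], _ => exact List.singleton_perm.1 hp
        | a :: b :: l, h2 => exact absurd (by simp) h2
      rw [this]
  | swap a b l => exact h.normalForm_swap b a l
  | trans _ _ ih₁ ih₂ => exact ih₁.trans ih₂

/-- A letter with `i ≠ 0` anticommutes past the leading `y 0 p`, until a list of length two remains,
where four products are checked. The length bound is essential: on a one-element list `normalForm`
ignores the entry `(1, 1)` and is meaningful only for traceless matrices. -/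
theorem mul_normalForm (h : GenericRelations y) (i : Fin 3) (r : P) (l : List P)
    (hl : 2 ≤ l.length) (m : M2) :
    y i r * normalForm y l m = normalForm y (r :: l) (v i * m) := by
  by_cases hi : i = 0
  · subst hi
    rw [normalForm_cons y r hl, ← mul_assoc, v_zero_mul_self, one_mul]
  match l, hl with
  | [p, q], _ =>
    rw [normalForm_cons y r (by simp), normalForm_pair, normalForm_pair]
    fin_cases i
    · exact absurd rfl hi
    · have e1 : y 1 r * (y 1 p * y 2 q) = 0 := by
        rw [← mul_assoc, h.sq 1 (by decide), zero_mul]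
      have e2 : y 1 r * (y 2 p * y 1 q) = y 0 r * (y 0 p * y 1 q) := by
        rw [← mul_assoc, ← mul_assoc, h.triple 1 2 (by decide) (by decide) (by decide)]
      have e3 : y 1 r * (y 0 p * y 1 q) = 0 := by
        rw [← mul_assoc, h.anticomm 1 (by decide), neg_mul, mul_assoc, h.sq 1 (by decide),
          mul_zero, neg_zero]
      have e4 : y 1 r * (y 0 p * y 2 q) = -(y 0 r * (y 1 p * y 2 q)) := by
        rw [← mul_assoc, h.anticomm 1 (by decide), h.swap_zero 1 (by decide), neg_mul, mul_assoc]
      simp [v, mul_add, mul_sub, Matrix.mul_apply, Matrix.vecMul, Matrix.vecHead, Matrix.vecTail, e1, e2, e3, e4]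
      abel
    · have e1 : y 2 r * (y 2 p * y 1 q) = 0 := by
        rw [← mul_assoc, h.sq 2 (by decide), zero_mul]
      have e2 : y 2 r * (y 1 p * y 2 q) = y 0 r * (y 0 p * y 2 q) := by
        rw [← mul_assoc, ← mul_assoc, h.triple 2 1 (by decide) (by decide) (by decide)]
      have e3 : y 2 r * (y 0 p * y 2 q) = 0 := by
        rw [← mul_assoc, h.anticomm 2 (by decide), neg_mul, mul_assoc, h.sq 2 (by decide),
          mul_zero, neg_zero]
      have e4 : y 2 r * (y 0 p * y 1 q) = -(y 0 r * (y 2 p * y 1 q)) := by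
        rw [← mul_assoc, h.anticomm 2 (by decide), h.swap_zero 2 (by decide), neg_mul, mul_assoc]
      simp [v, mul_add, mul_sub, Matrix.mul_apply, Matrix.vecMul, Matrix.vecHead, Matrix.vecTail, e1, e2, e3, e4]
      abel
  | p :: q :: s :: l, _ =>
    rw [normalForm_cons y p (l := q :: s :: l) (by simp), ← mul_assoc, h.anticomm i hi, neg_mul, mul_assoc,
      h.mul_normalForm i r (q :: s :: l) (by simp), ← mul_neg, ← map_neg, ← mul_assoc,
      h.normalForm_swap r p, normalForm_cons y p (l := r :: q :: s :: l) (by simp),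
      ← mul_assoc (v 0), v_zero_mul i hi,
      neg_mul]

theorem mul_eq_normalForm (h : GenericRelations y) (i j : Fin 3) (p q : P) :
    y i p * y j q = normalForm y [p, q] (v i * v j) := by
  have e1 : y 0 p * y 0 q = y 1 p * y 2 q + y 2 p * y 1 q := by
    rw [← h.add, h.swap q p, add_comm]
  have e2 : y 1 p * y 0 q = -(y 0 p * y 1 q) := by
    rw [h.anticomm 1 (by decide), h.swap_zero 1 (by decide)]
  have e3 : y 2 p * y 0 q = -(y 0 p * y 2 q) := by
    rw [h.anticomm 2 (by decide), h.swap_zero 2 (by decide)]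
  have e4 := h.sq 1 (by decide) p q
  have e5 := h.sq 2 (by decide) p q
  rw [normalForm_pair]
  fin_cases i <;> fin_cases j <;> simp [v, e1, e2, e3, e4, e5]

theorem prod_eq_normalForm (h : GenericRelations y) : ∀ w : List (Fin 3 × P),
    (w.map fun a => y a.1 a.2).prod =
      normalForm y (w.map Prod.snd) (w.map fun a => v a.1).prod
  | [] => by simp [normalForm_nil]
  | [a] => by
    rcases a with ⟨i, p⟩
    fin_cases i <;> simp [normalForm_singleton, v]
  | [a, b] => by simpa using h.mul_eq_normalForm a.1 b.1 a.2 b.2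
  | a :: b :: c :: w => by
    have ih := h.prod_eq_normalForm (b :: c :: w)
    rw [List.map_cons, List.prod_cons, ih, h.mul_normalForm _ _ _ (by simp)]
    rfl

end GenericRelations

/-- The homomorphism to `2 × 2` matrices over a polynomial ring with `(i, p) ↦ t_p • vᵢ`. -/
def genericEval (P : Type*) :
    FreeAlgebra ℂ (Fin 3 × P) →ₐ[ℂ] Matrix (Fin 2) (Fin 2) (MvPolynomial P ℂ) :=
  FreeAlgebra.lift ℂ fun a => (MvPolynomial.X a.2 : MvPolynomial P ℂ) • (v a.1).map MvPolynomial.C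

theorem genericEval_prod (w : List (Fin 3 × P)) :
    genericEval P (w.map (FreeAlgebra.ι ℂ)).prod =
      (MvPolynomial.monomial (w.map fun a => Finsupp.single a.2 1).sum (1 : ℂ)) •
        ((w.map fun a => v a.1).prod).map MvPolynomial.C := by
  induction w with
  | nil => simp [Matrix.map_one _ (map_zero _) (map_one MvPolynomial.C)]
  | cons a w ih =>
    rw [List.map_cons, List.prod_cons, map_mul, ih]
    simp only [List.map_cons, List.prod_cons, List.sum_cons]
    rw [Matrix.map_mul, ← mul_one (1 : ℂ), ← MvPolynomial.monomial_mul, mul_one, mul_smul]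
    simp [genericEval, MvPolynomial.X]
    exact smul_comm _ _ _

/-- Linear extension of `t^n • m ↦ normalForm y n m` to all matrices with polynomial entries. -/
def normalFormPoly (y : Fin 3 → P → Q) : Matrix (Fin 2) (Fin 2) (MvPolynomial P ℂ) →ₗ[ℂ] Q :=
  ∑ k, ∑ l, (MvPolynomial.basisMonomials P ℂ).constr ℂ
    (fun n => normalForm y (Finsupp.toMultiset n).toList (Matrix.single k l 1)) ∘ₗ
      Matrix.entryLinearMap ℂ (MvPolynomial P ℂ) k l

theorem normalFormPoly_monomial_smul (y : Fin 3 → P → Q) (n : P →₀ ℕ) (m : M2) :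
    normalFormPoly y (MvPolynomial.monomial n (1 : ℂ) • m.map MvPolynomial.C) =
      normalForm y (Finsupp.toMultiset n).toList m := by
  have h : ∀ k l, (MvPolynomial.basisMonomials P ℂ).constr ℂ
      (fun n => normalForm y (Finsupp.toMultiset n).toList (Matrix.single k l 1))
      ((MvPolynomial.monomial n (1 : ℂ) • m.map MvPolynomial.C) k l) =
        m k l • normalForm y (Finsupp.toMultiset n).toList (Matrix.single k l 1) := by
    intro k l
    have : (MvPolynomial.monomial n (1 : ℂ) • m.map MvPolynomial.C) k l =
        m k l • MvPolynomial.basisMonomials P ℂ n := by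
      simp [mul_comm, MvPolynomial.C_mul_monomial, MvPolynomial.smul_monomial]
    rw [this, map_smul, Module.Basis.constr_basis]
  simp only [normalFormPoly, LinearMap.sum_apply, LinearMap.comp_apply,
    Matrix.entryLinearMap_apply, h]
  conv_rhs => rw [Matrix.matrix_eq_sum_single m]
  simp only [map_sum]
  refine Finset.sum_congr rfl fun k _ => Finset.sum_congr rfl fun l _ => ?_
  rw [← map_smul, Matrix.smul_single, smul_eq_mul, mul_one]

/-- Both sides are linear, so words suffice. The generic value of a word remembers its indices only
as a multiset; by `normalForm_perm` the order chosen by `toList` is immaterial. -/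
theorem GenericRelations.lift_eq {y : Fin 3 → P → Q} (h : GenericRelations y)
    (b : FreeAlgebra ℂ (Fin 3 × P)) :
    FreeAlgebra.lift ℂ (fun a : Fin 3 × P => y a.1 a.2) b =
      normalFormPoly y (genericEval P b) := by
  suffices H : (FreeAlgebra.lift ℂ fun a : Fin 3 × P => y a.1 a.2).toLinearMap =
      normalFormPoly y ∘ₗ (genericEval P).toLinearMap from LinearMap.congr_fun H b
  refine (FreeAlgebra.basisFreeMonoid ℂ (Fin 3 × P)).ext fun w => ?_
  have hw : FreeAlgebra.basisFreeMonoid ℂ (Fin 3 × P) w =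
      (w.toList.map (FreeAlgebra.ι ℂ)).prod := by
    simp [FreeAlgebra.basisFreeMonoid, FreeAlgebra.equivMonoidAlgebraFreeMonoid,
      FreeMonoid.lift_apply]
  rw [hw]
  simp only [AlgHom.toLinearMap_apply, LinearMap.comp_apply]
  rw [genericEval_prod, normalFormPoly_monomial_smul, map_list_prod, List.map_map]
  have h1 := h.prod_eq_normalForm w.toList
  have h2 : (w.toList.map Prod.snd).Perm
      (Finsupp.toMultiset (w.toList.map fun a => Finsupp.single a.2 1).sum).toList := by
    rw [← Multiset.coe_eq_coe, Multiset.coe_toList]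
    induction w.toList with
    | nil => simp
    | cons a l ih => simp [← ih, Multiset.singleton_add]
  rw [← h.normalForm_perm h2, ← h1]
  congr 1
  exact List.map_congr_left fun a _ => by simp

/-- An element of the free algebra that vanishes for all `(i, p) ↦ t_p • vᵢ`, `t_p ∈ ℂ`, vanishes
on every family which satisfies the relations. -/
theorem GenericRelations.lift_eq_zero {y : Fin 3 → P → Q} (h : GenericRelations y)
    {b : FreeAlgebra ℂ (Fin 3 × P)}
    (hb : ∀ t : P → ℂ, FreeAlgebra.lift ℂ (fun a : Fin 3 × P => t a.2 • v a.1) b = 0) :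
    FreeAlgebra.lift ℂ (fun a : Fin 3 × P => y a.1 a.2) b = 0 := by
  have hev : ∀ t : P → ℂ, (MvPolynomial.aeval t).mapMatrix.comp (genericEval P) =
      FreeAlgebra.lift ℂ (fun a : Fin 3 × P => t a.2 • v a.1) := by
    intro t
    refine FreeAlgebra.hom_ext (funext fun a => ?_)
    ext k l
    simp [genericEval]
  have h0 : genericEval P b = 0 := by
    ext1 k l
    refine MvPolynomial.funext fun t => ?_
    have := congrFun (congrFun (AlgHom.congr_fun (hev t) b) k) l
    rw [hb] at this
    simpa [MvPolynomial.aeval_eq_eval] using this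
  rw [h.lift_eq, h0, map_zero]

end

/-! ### Substitutions, and the listed polynomials as weak identities -/

section

/-- The map `z ↦ z(xᵢ)` as a linear map. -/
def opVarLinear {G : Type*} (i : ℕ) : MonoidAlgebra ℂ G →ₗ[ℂ] FreeGAlgebra G :=
  Finsupp.linearCombination ℂ (X i) ∘ₗ (MonoidAlgebra.coeffLinearEquiv ℂ).toLinearMap

theorem opVarLinear_apply {G : Type*} (i : ℕ) (z : MonoidAlgebra ℂ G) : opVarLinear i z = opVar z i := rfl

/-- A homomorphism of associative algebras that maps the variables to a Lie subalgebra maps the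
free Lie `G`-algebra to it. -/
theorem map_freeLie_mem {G A : Type*} [Ring A] [Algebra ℂ A] (θ : FreeGAlgebra G →ₐ[ℂ] A)
    (K : LieSubalgebra ℂ A) (h : ∀ i g, θ (X i g) ∈ K) {f : FreeGAlgebra G}
    (hf : f ∈ freeLie G) : θ f ∈ K := by
  have hle : freeLie G ≤ K.comap θ.toLieHom := by
    refine LieSubalgebra.lieSpan_le.2 ?_
    rintro _ ⟨⟨i, g⟩, rfl⟩
    exact h i g
  exact hle hf

theorem X_mem_freeLie {G : Type*} (i : ℕ) (g : G) : X i g ∈ freeLie G :=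
  LieSubalgebra.subset_lieSpan ⟨(i, g), rfl⟩

variable {G : Type*} [Group G]

theorem opVarLinear_of (i : ℕ) (g : G) : opVarLinear i (MonoidAlgebra.of ℂ G g) = X i g := by
  simp [opVarLinear]

theorem eval_opVar (φ : G →* (M2 ≃ₐ[ℂ] M2)) (a : ℕ → M2) (z : MonoidAlgebra ℂ G) (i : ℕ) :
    eval φ a (opVar z i) = groupAlgebraAct φ z (a i) := by
  rw [← opVarLinear_apply]
  induction z using MonoidAlgebra.induction_on with
  | of g =>
    rw [opVarLinear_of, groupAlgebraAct_of]
    simp [eval]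
  | add a b ha hb => simp [ha, hb]
  | smul r a ha => simp [ha]

theorem eval_X (φ : G →* (M2 ≃ₐ[ℂ] M2)) (a : ℕ → M2) (i : ℕ) (g : G) :
    eval φ a (X i g) = φ g (a i) := by
  simp [eval]

theorem gAct_X (g : G) (i : ℕ) (h : G) : gAct g (X i h) = X i (g * h) := by
  simp [gAct]

/-- The endomorphism that commutes with the action of `G` and replaces `xᵢ` by the variable
`τ i`. -/
def substVar (τ : ℕ → ℕ × G) : FreeGAlgebra G →ₐ[ℂ] FreeGAlgebra G :=
  FreeAlgebra.lift ℂ fun p => X (τ p.1).1 (p.2 * (τ p.1).2)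

theorem substVar_X (τ : ℕ → ℕ × G) (i : ℕ) (g : G) :
    substVar τ (X i g) = X (τ i).1 (g * (τ i).2) := by
  simp [substVar]

theorem isPairEndomorphism_substVar (τ : ℕ → ℕ × G) : IsPairEndomorphism (substVar τ) := by
  refine ⟨fun g f => ?_, fun f hf => map_freeLie_mem _ _ (fun i g => ?_) hf⟩
  · have : (substVar τ).comp (gAct g) = (gAct g).comp (substVar τ) := by
      refine FreeAlgebra.hom_ext (funext fun p => ?_)
      change substVar τ (gAct g (X p.1 p.2)) = gAct g (substVar τ (X p.1 p.2))
      rw [gAct_X, substVar_X, substVar_X, gAct_X, mul_assoc]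
    exact AlgHom.congr_fun this f
  · rw [substVar_X]
    exact X_mem_freeLie _ _

theorem substVar_opVar (τ : ℕ → ℕ × G) (z : MonoidAlgebra ℂ G) (i : ℕ) :
    substVar τ (opVar z i) = opVar (z * MonoidAlgebra.of ℂ G (τ i).2) (τ i).1 := by
  simp only [← opVarLinear_apply]
  induction z using MonoidAlgebra.induction_on with
  | of g => rw [← map_mul, opVarLinear_of, opVarLinear_of, substVar_X]
  | add a b ha hb => simp only [map_add, add_mul, ha, hb]
  | smul r a ha => simp only [map_smul, smul_mul_assoc, ha]

theorem isWeakGIdeal_weakIdentities (φ : G →* (M2 ≃ₐ[ℂ] M2)) :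
    IsWeakGIdeal (weakIdentities φ) := by
  intro θ hθ f hf
  rw [mem_weakIdentities] at hf ⊢
  intro a ha
  -- Evaluation after `θ` is evaluation at new matrices, since `θ` commutes with `G`; they are
  -- traceless because `θ` preserves the free Lie algebra.
  have h : (eval φ a).comp θ = eval φ fun i => eval φ a (θ (X i 1)) := by
    refine FreeAlgebra.hom_ext (funext fun p => ?_)
    change eval φ a (θ (X p.1 p.2)) = eval φ (fun i => eval φ a (θ (X i 1))) (X p.1 p.2)
    have hg : ∀ (g : G) (b : FreeGAlgebra G), eval φ a (gAct g b) = φ g (eval φ a b) := by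
      intro g b
      have : (eval φ a).comp (gAct g) = (φ g : M2 →ₐ[ℂ] M2).comp (eval φ a) := by
        refine FreeAlgebra.hom_ext (funext fun q => ?_)
        change eval φ a (gAct g (X q.1 q.2)) = φ g (eval φ a (X q.1 q.2))
        rw [gAct_X, eval_X, eval_X, map_mul]
        rfl
      exact AlgHom.congr_fun this b
    rw [eval_X, ← hg, ← hθ.1, gAct_X, mul_one]
  have := hf (fun i => eval φ a (θ (X i 1))) fun i =>
    map_freeLie_mem (eval φ a) sl2 (fun j g => by
      rw [eval_X]
      exact algEquiv_mem_sl2 _ (ha j)) (hθ.2 _ (X_mem_freeLie i 1))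
  rw [← h] at this
  exact this

theorem genericRelations_smul_v {P : Type*} (t : P → ℂ) :
    GenericRelations fun i p => t p • v i := by
  have sq : ∀ i, i ≠ 0 → v i * v i = 0 := by
    intro i hi
    ext k l
    fin_cases i
    · exact absurd rfl hi
    all_goals fin_cases k <;> fin_cases l <;> simp [v]
  have triple : ∀ i j, i ≠ 0 → j ≠ 0 → i ≠ j → v i * v j * v i = v 0 * v 0 * v i := by
    intro i j hi hj hij
    ext k l
    fin_cases i <;> fin_cases j <;> first
      | exact absurd rfl hi
      | exact absurd rfl hj
      | exact absurd rfl hij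
      | fin_cases k <;> fin_cases l <;> simp [v]
  have add : v 2 * v 1 + v 1 * v 2 = v 0 * v 0 := by
    ext k l
    fin_cases k <;> fin_cases l <;> simp [v]
  refine ⟨fun p q => ?_, fun i hi p q => ?_, fun i j hi hj hij p q r => ?_, fun i hi p q => ?_,
    fun p q => ?_, fun j _ p q => ?_, fun p q => ?_⟩ <;> simp only [smul_mul_smul_comm]
  · rw [mul_comm]
  · rw [v_zero_mul i hi, smul_neg, neg_neg, mul_comm]
  · rw [triple i j hi hj hij]
  · rw [sq i hi, smul_zero]
  · rw [mul_comm (t q), ← smul_add, add]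
  · rw [mul_comm]
  · rw [mul_comm]

theorem IsEpsilon.isListed_mem_weakIdentities {φ : G →* (M2 ≃ₐ[ℂ] M2)}
    {ε : Fin 3 → Fin 3 → MonoidAlgebra ℂ G} (h : IsEpsilon φ ε) {f : FreeGAlgebra G}
    (hf : IsListed ε f) : f ∈ weakIdentities φ := by
  rw [mem_weakIdentities]
  intro a ha
  have he : ∀ i α m, eval φ a (opVar (ε i α) m) = coord α (a m) • v i := fun i α m => by
    rw [eval_opVar, h.apply i α (ha m)]
  have hr := genericRelations_smul_v fun p : ℕ × Fin 3 => coord p.2 (a p.1)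
  cases hf with
  | one =>
    rw [map_sub, map_add, map_add, he, he, he, eval_X, map_one, AlgEquiv.one_apply,
      ← Fin.sum_univ_three (f := fun i => coord i (a 1) • v i), sum_coord_smul_v (ha 1), sub_self]
  | two α β =>
    simp only [map_sub, map_mul, he]
    exact sub_eq_zero.2 (hr.comm (1, α) (2, β))
  | three α i j hi =>
    simp only [map_add, map_mul, he]
    exact (congrArg _ (hr.anticomm i hi (2, j) (1, α))).trans (add_neg_cancel _)
  | four i j α β γ hi hj hij =>
    simp only [map_sub, map_mul, he]
    exact sub_eq_zero.2 (hr.triple i j hi hj hij (1, α) (2, β) (3, γ))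
  | five i α β hi =>
    simp only [map_mul, he]
    exact hr.sq i hi (1, α) (2, β)
  | six α β =>
    simp only [map_sub, map_add, map_mul, he]
    exact sub_eq_zero.2 (hr.add (1, α) (2, β))
  | seven j α β hj =>
    simp only [map_sub, map_mul, he]
    rw [smul_mul_smul_comm, smul_mul_smul_comm, mul_comm, sub_self]
  | eight α β =>
    simp only [map_sub, map_mul, he]
    rw [smul_mul_smul_comm, smul_mul_smul_comm, mul_comm, sub_self]

end

/-! ### Every weak identity follows from the list -/

section

/-- The quotient of `ℂ⟨X; G⟩` by a two-sided ideal, as a homomorphism of algebras. -/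
def quotientMap {G : Type*} (I : TwoSidedIdeal (FreeGAlgebra G)) :
    FreeGAlgebra G →ₐ[ℂ] I.ringCon.Quotient :=
  RingCon.mkₐ ℂ I.ringCon

theorem quotientMap_eq_zero_iff {G : Type*} (I : TwoSidedIdeal (FreeGAlgebra G)) (f : FreeGAlgebra G) :
    quotientMap I f = 0 ↔ f ∈ I := by
  conv_rhs => rw [← TwoSidedIdeal.ker_ringCon_mk' I, TwoSidedIdeal.mem_ker]
  rfl

variable {G : Type*} [Group G]

/-- The substitution `x₁ ↦ x_m`, `x₂ ↦ x_n`, `x₃ ↦ x_r`. -/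
def substThree (m n r : ℕ) : FreeGAlgebra G →ₐ[ℂ] FreeGAlgebra G :=
  substVar fun i => (if i = 1 then m else if i = 2 then n else r, 1)

theorem substThree_opVar (m n r : ℕ) (z : MonoidAlgebra ℂ G) (i : ℕ) :
    substThree m n r (opVar z i) = opVar z (if i = 1 then m else if i = 2 then n else r) := by
  rw [substThree, substVar_opVar, map_one, mul_one]

/-- Modulo a weak `G`-ideal that contains the listed polynomials, the elements `εᵢⱼ(x_m)` satisfy
the relations of the elements `t_p • vᵢ`. -/
theorem genericRelations_quotientMap {ε : Fin 3 → Fin 3 → MonoidAlgebra ℂ G}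
    {I : TwoSidedIdeal (FreeGAlgebra G)} (hI : IsWeakGIdeal I) (hε : ∀ f, IsListed ε f → f ∈ I) :
    GenericRelations fun (i : Fin 3) (p : ℕ × Fin 3) => quotientMap I (opVar (ε i p.2) p.1) := by
  have key : ∀ (m n r : ℕ) {f}, IsListed ε f → quotientMap I (substThree m n r f) = 0 :=
    fun m n r f hf => (quotientMap_eq_zero_iff I _).2
      (hI _ (isPairEndomorphism_substVar _) f (hε f hf))
  refine ⟨fun p q => ?_, fun i hi p q => ?_, fun i j hi hj hij p q r => ?_, fun i hi p q => ?_,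
    fun p q => ?_, fun j hj p q => ?_, fun p q => ?_⟩
  -- Only the fourth family involves `x₃`; elsewhere the index `0` is a dummy.
  · simpa [substThree_opVar, sub_eq_zero] using key p.1 q.1 0 (.two p.2 q.2)
  · simpa [substThree_opVar, eq_neg_iff_add_eq_zero, add_comm] using
      key q.1 p.1 0 (.three q.2 i p.2 hi)
  · simpa [substThree_opVar, sub_eq_zero] using
      key p.1 q.1 r.1 (.four i j p.2 q.2 r.2 hi hj hij)
  · simpa [substThree_opVar] using key p.1 q.1 0 (.five i p.2 q.2 hi)
  · simpa [substThree_opVar, sub_eq_zero] using key p.1 q.1 0 (.six p.2 q.2)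
  · simpa [substThree_opVar, sub_eq_zero] using key p.1 q.1 0 (.seven j p.2 q.2 hj)
  · simpa [substThree_opVar, sub_eq_zero] using key p.1 q.1 0 (.eight p.2 q.2)

/-- Relation 1 with `x₁` replaced by `x_m^g` turns the variable into `((ε₁₁ + ε₂₂ + ε₃₃) g)(x_m)`,
which `sum_mul_eq` expands in the matrix units. -/
theorem quotientMap_X {ε : Fin 3 → Fin 3 → MonoidAlgebra ℂ G}
    {I : TwoSidedIdeal (FreeGAlgebra G)} (hI : IsWeakGIdeal I) (hε : ∀ f, IsListed ε f → f ∈ I)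
    {φ : G →* (M2 ≃ₐ[ℂ] M2)} (h : IsEpsilon φ ε) (m : ℕ) (g : G) :
    quotientMap I (X m g) =
      ∑ i, ∑ j, coord i (φ g (v j)) • quotientMap I (opVar (ε i j) m) := by
  have h1 := hI _ (isPairEndomorphism_substVar fun _ => (m, g)) _ (hε _ .one)
  rw [← quotientMap_eq_zero_iff, map_sub, map_sub, sub_eq_zero, substVar_X, one_mul] at h1
  rw [← h1]
  simp only [map_add, substVar_opVar]
  simp only [← opVarLinear_apply, ← map_add, ← add_mul]
  rw [h.sum_mul_eq]
  simp only [map_sum, map_smul, groupAlgebraAct_of]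

/-- The expression of the variables `x_m^g` in terms of the elements `εᵢⱼ(x_m)`, considered as free
variables. -/
def reduceVar (φ : G →* (M2 ≃ₐ[ℂ] M2)) :
    FreeGAlgebra G →ₐ[ℂ] FreeAlgebra ℂ (Fin 3 × (ℕ × Fin 3)) :=
  FreeAlgebra.lift ℂ fun p => ∑ i, ∑ j, coord i (φ p.2 (v j)) • FreeAlgebra.ι ℂ (i, (p.1, j))

theorem reduceVar_X (φ : G →* (M2 ≃ₐ[ℂ] M2)) (m : ℕ) (g : G) :
    reduceVar φ (X m g) =
      ∑ i, ∑ j, coord i (φ g (v j)) • FreeAlgebra.ι ℂ (i, (m, j)) := by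
  simp [reduceVar]

theorem lift_reduceVar (φ : G →* (M2 ≃ₐ[ℂ] M2)) (t : ℕ × Fin 3 → ℂ) :
    (FreeAlgebra.lift ℂ fun a : Fin 3 × (ℕ × Fin 3) => t a.2 • v a.1).comp (reduceVar φ) =
      eval φ fun m => ∑ j, t (m, j) • v j := by
  refine FreeAlgebra.hom_ext (funext fun p => ?_)
  change FreeAlgebra.lift ℂ _ (reduceVar φ (X p.1 p.2)) = eval φ _ (X p.1 p.2)
  rw [reduceVar_X, eval_X]
  simp only [map_sum, map_smul, FreeAlgebra.lift_ι_apply]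
  rw [Finset.sum_comm]
  refine Finset.sum_congr rfl fun j _ => ?_
  rw [← sum_coord_smul_v (algEquiv_mem_sl2 (φ p.2) (v_mem_sl2 j)), Finset.smul_sum]
  simp only [coord_sum_smul_v]
  exact Finset.sum_congr rfl fun i _ => smul_comm _ _ _

theorem IsEpsilon.isBasisOfWeakIdentities {φ : G →* (M2 ≃ₐ[ℂ] M2)}
    {ε : Fin 3 → Fin 3 → MonoidAlgebra ℂ G} (h : IsEpsilon φ ε) :
    IsBasisOfWeakIdentities φ {f | IsListed ε f} := by
  refine ⟨⟨isWeakGIdeal_weakIdentities φ, fun f hf => h.isListed_mem_weakIdentities hf⟩, ?_⟩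
  rintro I ⟨hI, hε⟩ f hf
  replace hε : ∀ f, IsListed ε f → f ∈ I := fun f hf => hε hf
  -- The quotient map factors through the free algebra on the symbols `εᵢⱼ(x_m)`, so it suffices
  -- that the image of `f` there vanishes at all `t_p • vᵢ`; by `lift_reduceVar` these are values of
  -- `f` on traceless matrices.
  have hq : (FreeAlgebra.lift ℂ fun a : Fin 3 × (ℕ × Fin 3) =>
      quotientMap I (opVar (ε a.1 a.2.2) a.2.1)).comp (reduceVar φ) = quotientMap I := by
    refine FreeAlgebra.hom_ext (funext fun p => ?_)
    change FreeAlgebra.lift ℂ _ (reduceVar φ (X p.1 p.2)) = quotientMap I (X p.1 p.2)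
    rw [reduceVar_X, quotientMap_X hI hε h]
    simp only [map_sum, map_smul, FreeAlgebra.lift_ι_apply]
  rw [← quotientMap_eq_zero_iff, ← hq]
  refine (genericRelations_quotientMap hI hε).lift_eq_zero fun t => ?_
  have := (mem_weakIdentities φ f).1 hf (fun m => ∑ j, t (m, j) • v j)
    fun m => sum_smul_v_mem_sl2 _
  rwa [← lift_reduceVar] at this

end

end

end WeakGIdentities

theorem mainTheorem4 {G : Type*} [Group G]
    (hG : Nonempty (G ≃* alternatingGroup (Fin 4)) ∨ Nonempty (G ≃* alternatingGroup (Fin 5)) ∨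
      Nonempty (G ≃* Equiv.Perm (Fin 4)))
    (φ : G →* (WeakGIdentities.M2 ≃ₐ[ℂ] WeakGIdentities.M2)) (hφ : Function.Injective φ) :
    (∃! ε : Fin 3 → Fin 3 → MonoidAlgebra ℂ G, WeakGIdentities.IsEpsilon φ ε) ∧
    ∀ ε : Fin 3 → Fin 3 → MonoidAlgebra ℂ G, WeakGIdentities.IsEpsilon φ ε →
      (∀ i j k l, ε i j * ε k l = if j = k then ε i l else 0) ∧
      WeakGIdentities.IsBasisOfWeakIdentities φ {f | WeakGIdentities.IsListed ε f} := by
  obtain ⟨ε, hε⟩ := WeakGIdentities.exists_isEpsilon hG hφ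
  exact ⟨⟨ε, hε, fun ε' hε' => WeakGIdentities.isEpsilon_unique hε' hε⟩,
    fun ε hε => ⟨hε.mul_eq, hε.isBasisOfWeakIdentities⟩⟩
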